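/- Let $A_l\in\mathbb{R}^{m_l\times n_x}$, $A_f\in\mathbb{R}^{m_f\times n_x}$, $B_f\in\mathbb{R}^{m_f\times n_y}$, $b_l\in\mathbb{R}^{m_l}$, $b_f\in\mathbb{R}^{m_f}$, $d_1\in\mathbb{R}^{n_x}$, $d_2\in\mathbb{R}^{n_y}$, and assume that the polyhedron $$D=\{(x,y)\in\mathbb{R}^{n_x}\times\mathbb{R}^{n_y} : A_lx\le b_l,\ A_fx+B_fy\le b_f\}$$ is compact and has nonempty interior. Let $\pi(x,y)=x$, let $X=\pi(D)$, let $Y$ be the projection of $D$ to $\mathbb{R}^{n_y}$, and let $S(x)=\{y:(x,y)\in D\}$ for $x\in X$. A face of a polyhedron is the set of maximizers of a linear function over it, and $\mathrm{ext}(P)$ denotes the set of vertices (zero-dimensional faces) of $P$. For $x\in X$, the chamber of $x$ is $\sigma(x)=\bigcap\{\pi(F): F \text{ a face of } D,\ x\in\pi(F)\}$; the chamber complex is the finite collection $\mathscr{C}(D)=\{\sigma(x):x\in X\}$, and the set of chamber vertices is $\mathscr{V}(D)=\{v\in X:\{v\}\in\mathscr{C}(D)\}$. A function $f:X\to\mathbb{R}$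 is piecewise linear over $\mathscr{C}(D)$ if there are pairs $(d_C,a_C)\in\mathbb{R}^{n_x}\times\mathbb{R}$, $C\in\mathscr{C}(D)$, with $f(x)=\sum_{C\in\mathscr{C}(D)}(\langle d_C,x\rangle+a_C)\mathbf{1}_{\mathrm{ri}(C)}(x)$ for all $x\in X$. Let $(\Omega,\Sigma,\mathbb{P})$ be a probability space and let $c$ be a random vector on it with values in the unit sphere $\mathbb{S}$ of $\mathbb{R}^{n_y}$, whose distribution is nonatomic in the sense that $\mathbb{P}[c\in O]=0$ for every Borel set $O\subseteq\mathbb{S}$ with $\mathcal{H}^{n_y-1}(O)=0$. With $N_{S(x)}(y)=\{d:\langle d,z-y\rangle\le 0\ \forall z\in S(x)\}$, define for $x\in X$ the measure $$\beta_x(O)=\sum_{y\in\mathrm{ext}(S(x))}\mathbb{P}[-c\in N_{S(x)}(y)]\,\mathbf{1}_O(y),\qquad O\subseteq Y\text{ Borel}.$$ Then each $\beta_x$ is a probability measure on $Y$ with $\beta_x(S(x))=1$, and the following hold. 1. $\beta$ is weakly continuous: if $x_k\to x$ in $X$, then $\int_Y f\,d\beta_{x_k}\to\int_Y f\,d\beta_x$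 for every continuous $f:Y\to\mathbb{R}$. Moreover, for every lower semicontinuous $f:X\times Y\to\mathbb{R}$, the expectations $\mathbb{E}_{\beta_x}[f(x,\cdot)]$ exist and $x\mapsto\mathbb{E}_{\beta_x}[f(x,\cdot)]$ attains its minimum over $X$. 2. The function $\theta:X\to\mathbb{R}$, $\theta(x)=\langle d_1,x\rangle+\mathbb{E}_{\beta_x}[\langle d_2,\cdot\rangle]$, is continuous and piecewise linear over $\mathscr{C}(D)$, and its restriction to each chamber $C\in\mathscr{C}(D)$ is affine. In particular, there is a point of $\mathscr{V}(D)$ that minimizes $\theta$ over $X$ and that solves the bilevel problem $$\min_{x}\ \langle d_1,x\rangle+\mathbb{E}[\langle d_2,y(x,\omega)\rangle]\quad\text{s.t. } A_lx\le b_l,\ \ y(x,\omega)\in\operatorname*{argmin}_{y}\{\langle c(\omega),y\rangle : A_fx+B_fy\le b_f\}\ \text{ for a.e. }\omega\in\Omega.$$ -/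

import Mathlib

open MeasureTheory Filter Topology
open scoped Matrix RealInnerProductSpace

noncomputable section

namespace Bilevel

/-- `ℝⁿ` with its Euclidean norm and inner product. -/
abbrev Vec (n : ℕ) : Type := EuclideanSpace ℝ (Fin n)

/-- The unit sphere of `ℝⁿ`. -/
abbrev Sphere (n : ℕ) : Type := Metric.sphere (0 : Vec n) 1

/-! ### Convex-geometric notions -/

/-- The face lattice of `P`: the sets of maximizers over `P` of the linear functions. -/
def faces {E : Type*} [NormedAddCommGroup E] [NormedSpace ℝ E] (P : Set E) : Set (Set E) :=
  {F | ∃ l : E →L[ℝ] ℝ, F = {z | z ∈ P ∧ ∀ w ∈ P, l w ≤ l z}}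

/-- The vertices of `P`: its zero-dimensional faces. -/
def vertices {E : Type*} [NormedAddCommGroup E] [NormedSpace ℝ E] (P : Set E) : Set E :=
  {v | {v} ∈ faces P}

/-- The normal cone of `A` at `x`. -/
def normalCone {n : ℕ} (A : Set (Vec n)) (x : Vec n) : Set (Vec n) :=
  {d | ∀ y ∈ A, ⟪d, y - x⟫ ≤ 0}

/-! ### The polyhedron of the high-point relaxation, its projections and fibers -/

/-- The feasible set of the follower for the leader's decision `x`:
all `y` with `A_f x + B_f y ≤ b_f`. -/
def followerFeasible {nx ny mf : ℕ} (Af : Matrix (Fin mf) (Fin nx) ℝ)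
    (Bf : Matrix (Fin mf) (Fin ny) ℝ) (bf : Fin mf → ℝ) (x : Vec nx) : Set (Vec ny) :=
  {y | ∀ i, (Af *ᵥ x.ofLp) i + (Bf *ᵥ y.ofLp) i ≤ bf i}

/-- The polyhedron `D` of all `(x, y)` with `A_l x ≤ b_l` and `A_f x + B_f y ≤ b_f`. -/
def highPoint {nx ny ml mf : ℕ} (Al : Matrix (Fin ml) (Fin nx) ℝ) (bl : Fin ml → ℝ)
    (Af : Matrix (Fin mf) (Fin nx) ℝ) (Bf : Matrix (Fin mf) (Fin ny) ℝ) (bf : Fin mf → ℝ) :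
    Set (Vec nx × Vec ny) :=
  {p | (∀ i, (Al *ᵥ p.1.ofLp) i ≤ bl i) ∧ p.2 ∈ followerFeasible Af Bf bf p.1}

/-- The leader's feasible set `X = π(D)`. -/
def domX {nx ny : ℕ} (D : Set (Vec nx × Vec ny)) : Set (Vec nx) := Prod.fst '' D

/-- The ambient set `Y` of the follower's decisions: the projection of `D` to the second factor. -/
def domY {nx ny : ℕ} (D : Set (Vec nx × Vec ny)) : Set (Vec ny) := Prod.snd '' D

/-- The fiber map `S(x) = {y | (x, y) ∈ D}`. -/
def fiber {nx ny : ℕ} (D : Set (Vec nx × Vec ny)) (x : Vec nx) : Set (Vec ny) :=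
  {y | (x, y) ∈ D}

/-! ### The chamber complex -/

/-- The chamber `σ(x)`: the intersection of the projections, containing `x`, of faces of `D`. -/
def chamber {nx ny : ℕ} (D : Set (Vec nx × Vec ny)) (x : Vec nx) : Set (Vec nx) :=
  ⋂₀ {Q | x ∈ Q ∧ ∃ F ∈ faces D, Q = Prod.fst '' F}

/-- The chamber complex of `D`. -/
def chamberComplex {nx ny : ℕ} (D : Set (Vec nx × Vec ny)) : Set (Set (Vec nx)) :=
  chamber D '' domX D

/-- The chamber vertices: the points of `X` that form a zero-dimensional chamber. -/
def chamberVertices {nx ny : ℕ} (D : Set (Vec nx × Vec ny)) : Set (Vec nx) :=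
  {v | v ∈ domX D ∧ {v} ∈ chamberComplex D}

/-- A function on `X` is piecewise linear over the chamber complex if the latter is a finite
collection and the function is the sum, over the chambers `C`, of affine functions multiplied by
the indicator functions of the relative interiors of the `C`. -/
def IsPiecewiseLinear {nx ny : ℕ} (D : Set (Vec nx × Vec ny)) (f : domX D → ℝ) : Prop :=
  (chamberComplex D).Finite ∧
    ∃ (d : Set (Vec nx) → Vec nx) (a : Set (Vec nx) → ℝ), ∀ x : domX D,
      f x = ∑ᶠ C ∈ chamberComplex D,
        (intrinsicInterior ℝ C).indicator (fun z => ⟪d C, z⟫ + a C) (x : Vec nx)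

/-! ### Beliefs -/

/-- A map from `X` to the measures on `Y` is a belief over the fiber map `S` if each of its values
is a probability measure that concentrates on the fiber. -/
def IsBelief {nx ny : ℕ} (D : Set (Vec nx × Vec ny)) (β : domX D → Measure (domY D)) : Prop :=
  ∀ x : domX D, IsProbabilityMeasure (β x) ∧ β x {y | (y : Vec ny) ∈ fiber D x} = 1

/-- Weak continuity: convergence of points implies weak convergence of the measures. -/
def IsWeakContinuous {nx ny : ℕ} (D : Set (Vec nx × Vec ny))
    (β : domX D → Measure (domY D)) : Prop :=
  ∀ (u : ℕ → domX D) (x : domX D), Tendsto u atTop (𝓝 x) →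
    ∀ f : domY D → ℝ, Continuous f →
      Tendsto (fun k => ∫ y, f y ∂(β (u k))) atTop (𝓝 (∫ y, f y ∂(β x)))

/-- The law of the random unit vector `c` is nonatomic: it vanishes on the Borel sets of the
sphere that are null for the `(n-1)`-dimensional Hausdorff measure. -/
def HasNonatomicDistribution {n : ℕ} {Ω : Type*} [MeasurableSpace Ω] (P : Measure Ω)
    (c : Ω → Sphere n) : Prop :=
  ∀ O : Set (Sphere n), MeasurableSet O →
    Measure.hausdorffMeasure ((n : ℝ) - 1) O = 0 → P {ω | c ω ∈ O} = 0

/-- The probability that the opposite of the cost lies in the normal cone of `S(x)` at `y`. -/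
def vertexDensity {nx ny : ℕ} {Ω : Type*} [MeasurableSpace Ω] (D : Set (Vec nx × Vec ny))
    (P : Measure Ω) (c : Ω → Sphere ny) (x : Vec nx) (y : Vec ny) : ENNReal :=
  P {ω | -(c ω : Vec ny) ∈ normalCone (fiber D x) y}

lemma mem_domY_of_mem_vertices {nx ny : ℕ} (D : Set (Vec nx × Vec ny)) (x : Vec nx)
    (v : vertices (fiber D x)) : (v : Vec ny) ∈ domY D := by
  obtain ⟨v, l, hl⟩ := v
  have h : v ∈ ({v} : Set (Vec ny)) := rfl
  rw [hl] at h
  exact ⟨(x, v), h.1, rfl⟩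

/-- The vertex-supported belief induced by `c`: the measure `β_x` on `Y` that puts at each vertex
`v` of `S(x)` the mass `P[-c ∈ N_{S(x)}(v)]`. -/
def belief {nx ny : ℕ} {Ω : Type*} [MeasurableSpace Ω] (D : Set (Vec nx × Vec ny))
    (P : Measure Ω) (c : Ω → Sphere ny) (x : domX D) : Measure (domY D) :=
  Measure.sum fun v : vertices (fiber D x) =>
    vertexDensity D P c x v • Measure.dirac ⟨v, mem_domY_of_mem_vertices D x v⟩

/-- The leader's objective `θ(x) = ⟨d₁, x⟩ + E_{β_x}[⟨d₂, ·⟩]`. -/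
def theta {nx ny : ℕ} {Ω : Type*} [MeasurableSpace Ω] (D : Set (Vec nx × Vec ny))
    (P : Measure Ω) (c : Ω → Sphere ny) (d₁ : Vec nx) (d₂ : Vec ny) (x : domX D) : ℝ :=
  ⟪d₁, (x : Vec nx)⟫ + ∫ y, ⟪d₂, (y : Vec ny)⟫ ∂(belief D P c x)

/-! ### The stochastic bilevel problem -/

/-- `(x, y)` is feasible for the bilevel problem: `A_l x ≤ b_l`, and almost surely `y(ω)` solves
the follower's problem of minimizing `⟨c(ω), ·⟩` subject to `A_f x + B_f y ≤ b_f`. -/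
def IsFeasible {nx ny ml mf : ℕ} {Ω : Type*} [MeasurableSpace Ω]
    (Al : Matrix (Fin ml) (Fin nx) ℝ) (bl : Fin ml → ℝ)
    (Af : Matrix (Fin mf) (Fin nx) ℝ) (Bf : Matrix (Fin mf) (Fin ny) ℝ) (bf : Fin mf → ℝ)
    (P : Measure Ω) (c : Ω → Sphere ny) (x : Vec nx) (y : Ω → Vec ny) : Prop :=
  (∀ i, (Al *ᵥ x.ofLp) i ≤ bl i) ∧
    ∀ᵐ ω ∂P, y ω ∈ followerFeasible Af Bf bf x ∧
      ∀ z ∈ followerFeasible Af Bf bf x, ⟪(c ω : Vec ny), y ω⟫ ≤ ⟪(c ω : Vec ny), z⟫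

/-- The objective `⟨d₁, x⟩ + E[⟨d₂, y(ω)⟩]` of the bilevel problem. -/
def objective {nx ny : ℕ} {Ω : Type*} [MeasurableSpace Ω] (P : Measure Ω)
    (d₁ : Vec nx) (d₂ : Vec ny) (x : Vec nx) (y : Ω → Vec ny) : ℝ :=
  ⟪d₁, x⟫ + ∫ ω, ⟪d₂, y ω⟫ ∂P

/-- `x` solves the bilevel problem: it admits an optimal response, the expectation in the objective
exists at every feasible pair, and whichever optimal response to `x` is chosen, the objective is at
most its value at any other feasible pair. -/
def IsSolution {nx ny ml mf : ℕ} {Ω : Type*} [MeasurableSpace Ω]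
    (Al : Matrix (Fin ml) (Fin nx) ℝ) (bl : Fin ml → ℝ)
    (Af : Matrix (Fin mf) (Fin nx) ℝ) (Bf : Matrix (Fin mf) (Fin ny) ℝ) (bf : Fin mf → ℝ)
    (P : Measure Ω) (c : Ω → Sphere ny) (d₁ : Vec nx) (d₂ : Vec ny) (x : Vec nx) : Prop :=
  (∃ y, IsFeasible Al bl Af Bf bf P c x y) ∧
  (∀ x' y', IsFeasible Al bl Af Bf bf P c x' y' → Integrable (fun ω => ⟪d₂, y' ω⟫) P) ∧
  ∀ y, IsFeasible Al bl Af Bf bf P c x y →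
    ∀ x' y', IsFeasible Al bl Af Bf bf P c x' y' →
      objective P d₁ d₂ x y ≤ objective P d₁ d₂ x' y'

end Bilevel

end

open Bilevel

/-! Only finitely many sets `I` of constraints occur. For each one whose space `flat g I` of
vertical directions is nonzero, the unit costs orthogonal to that space lie in a great subsphere,
which is null for the Hausdorff measure of dimension `ny - 1`. Hence almost every cost is generic
(`ae_isGeneric`), and a generic cost has a unique minimizer over each fiber (`IsMinimizer.unique`).
The belief at `x` is therefore the law of the follower's response to `x` (`belief_eq_map`), and
every claim becomes one about the response.

The main tool is `IsMinimizer.of_mem_tight`: optimality at `(x₀, y₀)` passes to every point of the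
face cut out by the constraints active there. The graph of the response to a generic cost is thus a
finite union of faces. It is closed, so the response is continuous in `x`; dominated convergence
then gives weak continuity, and Fatou's lemma gives lower semicontinuity of the expectations.
Moreover, each point of the chamber of `x₀` lifts to the face through the response at `x₀`, on which
`y` is an affine function of `x`; so `θ` is affine on chambers.

Each point of `X` is relatively interior to its own chamber and to no other, which gives the
piecewise linear form. A minimum of `θ` is also attained at an extreme point of a chamber, and such
a point is its own chamber. -/

namespace Bilevel

/-! ### Relative interiors of convex sets -/

section RelativeInterior

variable {E : Type*} [NormedAddCommGroup E] [NormedSpace ℝ E]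

lemma mem_intrinsicInterior_iff_ball {C : Set E} {x : E} :
    x ∈ intrinsicInterior ℝ C ↔
      x ∈ C ∧ ∃ δ > 0, ∀ z ∈ affineSpan ℝ C, dist z x < δ → z ∈ C := by
  rw [mem_intrinsicInterior]
  constructor
  · rintro ⟨y, hy, rfl⟩
    refine ⟨Set.mem_preimage.1 (interior_subset hy), ?_⟩
    obtain ⟨δ, hδ, h⟩ := Metric.mem_nhds_iff.1 (mem_interior_iff_mem_nhds.1 hy)
    exact ⟨δ, hδ, fun z hz hd => @h ⟨z, hz⟩ hd⟩
  · rintro ⟨hx, δ, hδ, h⟩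
    refine ⟨⟨x, subset_affineSpan ℝ C hx⟩, ?_, rfl⟩
    rw [mem_interior_iff_mem_nhds, Metric.mem_nhds_iff]
    exact ⟨δ, hδ, fun z hz => h z z.2 hz⟩

lemma exists_pos_extend_of_mem_intrinsicInterior {C : Set E} {x z : E}
    (hx : x ∈ intrinsicInterior ℝ C) (hz : z ∈ C) : ∃ ε > (0 : ℝ), x + ε • (x - z) ∈ C := by
  obtain ⟨hxC, δ, hδ, h⟩ := mem_intrinsicInterior_iff_ball.1 hx
  have ht : Tendsto (fun ε : ℝ => x + ε • (x - z)) (𝓝[>] 0) (𝓝 x) := by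
    have : Continuous fun ε : ℝ => x + ε • (x - z) := by fun_prop
    simpa using (this.tendsto 0).mono_left nhdsWithin_le_nhds
  obtain ⟨ε, hε, hε0⟩ := ((ht.eventually (Metric.ball_mem_nhds x hδ)).and
    (self_mem_nhdsWithin : Set.Ioi (0 : ℝ) ∈ 𝓝[>] 0)).exists
  refine ⟨ε, hε0, h _ ?_ hε⟩
  have := AffineMap.lineMap_mem (1 + ε) (subset_affineSpan ℝ C hz) (subset_affineSpan ℝ C hxC)
  convert this using 1
  rw [AffineMap.lineMap_apply_module]
  module

/-- Extend the segment from a relatively interior point `w` through `x` to some `q` in `C`. The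
homothety centred at `q` with ratio `ε / (1 + ε)` sends `w` to `x` and carries a relative ball about
`w` to one about `x` inside `C`. -/
lemma mem_intrinsicInterior_of_forall_extend [FiniteDimensional ℝ E] {C : Set E}
    (hC : Convex ℝ C) {x : E} (hxC : x ∈ C)
    (h : ∀ z ∈ C, ∃ ε > (0 : ℝ), x + ε • (x - z) ∈ C) : x ∈ intrinsicInterior ℝ C := by
  obtain ⟨w, hw⟩ := Set.Nonempty.intrinsicInterior hC ⟨x, hxC⟩
  obtain ⟨hwC, δ, hδ, hball⟩ := mem_intrinsicInterior_iff_ball.1 hw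
  obtain ⟨ε, hε, hq⟩ := h w hwC
  have h1 : 0 < 1 + ε := by linarith
  refine mem_intrinsicInterior_iff_ball.2 ⟨hxC, ε / (1 + ε) * δ, by positivity, ?_⟩
  intro z hz hd
  set q := x + ε • (x - w) with hqdef
  have hz' : q + ((1 + ε) / ε) • (z - q) ∈ C := by
    apply hball
    · have := AffineMap.lineMap_mem ((1 + ε) / ε) (subset_affineSpan ℝ C hq) hz
      convert this using 1
      rw [AffineMap.lineMap_apply_module]
      module
    · have : q + ((1 + ε) / ε) • (z - q) - w = ((1 + ε) / ε) • (z - x) := by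
        have e1 : w = q + ((1 + ε) / ε) • (x - q) := by
          rw [hqdef]
          match_scalars <;> field_simp <;> ring
        rw [e1]
        module
      rw [dist_eq_norm, this, norm_smul, Real.norm_of_nonneg (by positivity), ← dist_eq_norm]
      calc (1 + ε) / ε * dist z x < (1 + ε) / ε * (ε / (1 + ε) * δ) := by gcongr
        _ = δ := by field_simp
  have := hC hq hz' (a := 1 / (1 + ε)) (b := ε / (1 + ε)) (by positivity) (by positivity)
    (by field_simp)
  convert this using 1
  match_scalars <;> field_simp <;> ring

end RelativeInterior

/-! ### Polyhedra and their faces -/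

section Polyhedron

variable {E : Type*} [NormedAddCommGroup E] [NormedSpace ℝ E] {ι : Type*}

/-- The polyhedron cut out by the inequalities `g i ≤ r i`. -/
def poly (g : ι → E →L[ℝ] ℝ) (r : ι → ℝ) : Set E := {p | ∀ i, g i p ≤ r i}

/-- The points of the polyhedron at which the inequalities of `I` are equalities. -/
def tight (g : ι → E →L[ℝ] ℝ) (r : ι → ℝ) (I : Set ι) : Set E :=
  {p | (∀ i, g i p ≤ r i) ∧ ∀ i ∈ I, g i p = r i}

/-- The set of inequalities that are equalities at `p`. -/
def act (g : ι → E →L[ℝ] ℝ) (r : ι → ℝ) (p : E) : Set ι := {i | g i p = r i}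

variable {g : ι → E →L[ℝ] ℝ} {r : ι → ℝ}

lemma tight_subset_poly (I : Set ι) : tight g r I ⊆ poly g r := fun _ h => h.1

lemma tight_empty : tight g r ∅ = poly g r := by
  ext p; simp [tight, poly]

lemma mem_tight_act {p : E} (hp : p ∈ poly g r) : p ∈ tight g r (act g r p) :=
  ⟨hp, fun _ hi => hi⟩

lemma convex_tight (I : Set ι) : Convex ℝ (tight g r I) := by
  intro p hp q hq a b ha hb hab
  refine ⟨fun i => ?_, fun i hi => ?_⟩
  · have h1 := mul_le_mul_of_nonneg_left (hp.1 i) ha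
    have h2 := mul_le_mul_of_nonneg_left (hq.1 i) hb
    have h3 : a * r i + b * r i = r i := by rw [← add_mul, hab, one_mul]
    simp only [map_add, map_smul, smul_eq_mul]
    linarith
  · have h3 : a * r i + b * r i = r i := by rw [← add_mul, hab, one_mul]
    simp only [map_add, map_smul, smul_eq_mul, hp.2 i hi, hq.2 i hi, h3]

lemma convex_poly : Convex ℝ (poly g r) := by
  rw [← tight_empty]
  exact convex_tight ∅

lemma isClosed_tight (I : Set ι) : IsClosed (tight g r I) := by
  have : tight g r I = (⋂ i, {p | g i p ≤ r i}) ∩ ⋂ i ∈ I, {p | g i p = r i} := by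
    ext p; simp [tight]
  rw [this]
  exact (isClosed_iInter fun i => isClosed_le (by fun_prop) continuous_const).inter
    (isClosed_biInter fun i _ => isClosed_eq (by fun_prop) continuous_const)

/-- Active constraints do not increase along `d`, and slack ones survive short steps. The filter
form lets finitely many such conditions share one step length. -/
lemma eventually_add_smul_mem_poly [Finite ι] {p d : E} (hp : p ∈ poly g r)
    (hd : ∀ i ∈ act g r p, g i d ≤ 0) : ∀ᶠ ε : ℝ in 𝓝[>] 0, p + ε • d ∈ poly g r := by
  simp only [poly, Set.mem_ofPred_eq]
  rw [eventually_all]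
  intro i
  rcases (hp i).lt_or_eq with h | h
  · have ht : Tendsto (fun ε : ℝ => g i (p + ε • d)) (𝓝[>] 0) (𝓝 (g i p)) := by
      have : Continuous fun ε : ℝ => g i (p + ε • d) := by fun_prop
      simpa using (this.tendsto 0).mono_left nhdsWithin_le_nhds
    exact (ht.eventually (gt_mem_nhds h)).mono fun _ => le_of_lt
  · filter_upwards [self_mem_nhdsWithin] with ε hε
    have := mul_nonpos_of_nonneg_of_nonpos (le_of_lt (Set.mem_Ioi.1 hε)) (hd i h)
    simp only [map_add, map_smul, smul_eq_mul, h]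
    linarith

lemma exists_pos_add_smul_mem_poly [Finite ι] {p d : E} (hp : p ∈ poly g r)
    (hd : ∀ i ∈ act g r p, g i d ≤ 0) : ∃ ε > (0 : ℝ), p + ε • d ∈ poly g r := by
  obtain ⟨ε, h, hε⟩ := ((eventually_add_smul_mem_poly hp hd).and
    (self_mem_nhdsWithin : Set.Ioi (0 : ℝ) ∈ 𝓝[>] 0)).exists
  exact ⟨ε, hε, h⟩

lemma exists_pos_extend_tight_act [Finite ι] {p q : E} (hp : p ∈ poly g r)
    (hq : q ∈ tight g r (act g r p)) :
    ∃ ε > (0 : ℝ), p + ε • (p - q) ∈ tight g r (act g r p) := by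
  have h0 : ∀ i ∈ act g r p, g i (p - q) = 0 := fun i hi => by
    rw [map_sub, hq.2 i hi, hi, sub_self]
  obtain ⟨ε, hε, h⟩ := exists_pos_add_smul_mem_poly hp (fun i hi => (h0 i hi).le)
  refine ⟨ε, hε, h, fun i hi => ?_⟩
  rw [map_add, map_smul, h0 i hi, hi, smul_zero, add_zero]

lemma act_midpoint_subset {p q : E} (hp : p ∈ poly g r) (hq : q ∈ poly g r) {a b : ℝ}
    (ha : 0 < a) (hb : 0 < b) (hab : a + b = 1) :
    act g r (a • p + b • q) ⊆ act g r p ∩ act g r q := by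
  intro i hi
  simp only [act, Set.mem_ofPred_eq, map_add, map_smul, smul_eq_mul] at hi
  have h1 := mul_le_mul_of_nonneg_left (hp i) ha.le
  have h2 := mul_le_mul_of_nonneg_left (hq i) hb.le
  have h3 : a * r i + b * r i = r i := by rw [← add_mul, hab, one_mul]
  exact ⟨mul_left_cancel₀ ha.ne' (by linarith), mul_left_cancel₀ hb.ne' (by linarith)⟩

/-- The exposing functional is the sum of the constraints in `I`. Nonemptiness makes the bound `∑ r
i` attained, and equality of the sums forces equality in each term. -/
lemma tight_mem_faces [Finite ι] {I : Set ι} (hne : (tight g r I).Nonempty) :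
    tight g r I ∈ faces (poly g r) := by
  classical
  have := Fintype.ofFinite ι
  obtain ⟨p, hp⟩ := hne
  have hle : ∀ w ∈ poly g r, ∑ i with i ∈ I, g i w ≤ ∑ i with i ∈ I, r i :=
    fun w hw => Finset.sum_le_sum fun i _ => hw i
  have hpe : ∑ i with i ∈ I, g i p = ∑ i with i ∈ I, r i :=
    Finset.sum_congr rfl fun i hi => hp.2 i (by simpa using hi)
  refine ⟨∑ i with i ∈ I, g i, ?_⟩
  ext q
  simp only [Set.mem_ofPred_eq, sum_apply]
  constructor
  · intro hq
    refine ⟨hq.1, fun w hw => (hle w hw).trans_eq ?_⟩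
    exact (Finset.sum_congr rfl fun i hi => hq.2 i (by simpa using hi)).symm
  · rintro ⟨hq, h⟩
    have he : ∑ i with i ∈ I, g i q = ∑ i with i ∈ I, r i :=
      le_antisymm (hle q hq) (hpe ▸ h p hp.1)
    refine ⟨hq, fun i hi => ?_⟩
    exact (Finset.sum_eq_sum_iff_of_le fun i _ => hq i).1 he i (by simpa using hi)

lemma exists_eq_tight_of_mem_faces [Finite ι] {F : Set E} (hF : F ∈ faces (poly g r))
    (hne : F.Nonempty) : ∃ I, F = tight g r I := by
  obtain ⟨l, rfl⟩ := hF
  set F := {z | z ∈ poly g r ∧ ∀ w ∈ poly g r, l w ≤ l z} with hFdef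
  -- A point `p` with minimal active set is generic in the face: averaging it with any other point
  -- `q` shows that the constraints active at `p` are active at `q`.
  obtain ⟨J, ⟨p, hp, rfl⟩, hmin⟩ :=
    (Set.toFinite (act g r '' F)).exists_minimal (hne.image _)
  have hconv : ∀ q ∈ F, (1 / 2 : ℝ) • p + (1 / 2 : ℝ) • q ∈ F := by
    intro q hq
    have hm : (1 / 2 : ℝ) • p + (1 / 2 : ℝ) • q ∈ poly g r :=
      convex_poly hp.1 hq.1 (by norm_num) (by norm_num) (by norm_num)
    refine ⟨hm, fun w hw => ?_⟩
    have h1 := hp.2 w hw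
    have h2 := hq.2 w hw
    simp only [map_add, map_smul, smul_eq_mul]
    linarith
  refine ⟨act g r p, Set.Subset.antisymm ?_ ?_⟩
  · intro q hq
    have hsub := act_midpoint_subset hp.1 hq.1 (a := 1 / 2) (b := 1 / 2) (by norm_num)
      (by norm_num) (by norm_num)
    have := hmin ⟨_, hconv q hq, rfl⟩ (hsub.trans Set.inter_subset_left)
    exact ⟨hq.1, fun i hi => (hsub (this hi)).2⟩
  · intro q hq
    refine ⟨hq.1, fun w hw => (hp.2 w hw).trans ?_⟩
    -- The segment from `q` can be prolonged beyond the maximizer `p`, so `l` cannot be smaller at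
    -- `q` than at `p`.
    obtain ⟨ε, hε, h⟩ := exists_pos_extend_tight_act hp.1 hq
    have := hp.2 _ h.1
    simp only [map_add, map_smul, smul_eq_mul, map_sub] at this
    have h2 : ε * (l p - l q) ≤ 0 := by linarith
    nlinarith [nonpos_of_mul_nonpos_right h2 hε]

end Polyhedron

/-! ### Minimizers over the fibers and the chamber complex -/

section Chambers

variable {nx ny : ℕ} {ι : Type*} {g : ι → (Vec nx × Vec ny) →L[ℝ] ℝ} {r : ι → ℝ}

/-- `y` minimizes `⟪c, ·⟫` over the fiber of `D` at `x`. -/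
def IsMinimizer (D : Set (Vec nx × Vec ny)) (c : Vec ny) (x : Vec nx) (y : Vec ny) : Prop :=
  (x, y) ∈ D ∧ ∀ z, (x, z) ∈ D → ⟪c, y⟫ ≤ ⟪c, z⟫

lemma isCompact_fiber {D : Set (Vec nx × Vec ny)} (hD : IsCompact D) (x : Vec nx) :
    IsCompact (fiber D x) := by
  have : fiber D x = Prod.snd '' (D ∩ Prod.fst ⁻¹' {x}) := by
    ext y
    simp only [fiber, Set.mem_ofPred_eq, Set.mem_image, Set.mem_inter_iff, Set.mem_preimage,
      Set.mem_singleton_iff, Prod.exists]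
    constructor
    · intro h
      exact ⟨x, y, ⟨h, rfl⟩, rfl⟩
    · rintro ⟨a, b, ⟨h, rfl⟩, rfl⟩
      exact h
  rw [this]
  exact (hD.inter_right (isClosed_singleton.preimage continuous_fst)).image continuous_snd

lemma exists_isMinimizer {D : Set (Vec nx × Vec ny)} (hD : IsCompact D) (c : Vec ny)
    {x : Vec nx} (hx : x ∈ domX D) : ∃ y, IsMinimizer D c x y := by
  obtain ⟨⟨_, y₀⟩, h₀, rfl⟩ := hx
  obtain ⟨y, hy, hmin⟩ := (isCompact_fiber hD _).exists_isMinOn ⟨y₀, h₀⟩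
    (f := fun y => ⟪c, y⟫) (by fun_prop)
  exact ⟨y, hy, fun z hz => hmin hz⟩

/-- A direction `z - y` feasible at `(x, y)` is feasible at `(x₀, y₀)` too, since the constraints
active there are also active at `(x, y)`. An improvement over `x` would thus yield one over `x₀`. -/
lemma IsMinimizer.of_mem_tight [Finite ι] {c : Vec ny} {x₀ x : Vec nx} {y₀ y : Vec ny}
    (h₀ : IsMinimizer (poly g r) c x₀ y₀) (h : (x, y) ∈ tight g r (act g r (x₀, y₀))) :
    IsMinimizer (poly g r) c x y := by
  refine ⟨h.1, fun z hz => ?_⟩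
  obtain ⟨ε, hε, hmem⟩ := exists_pos_add_smul_mem_poly (d := ((0 : Vec nx), z - y)) h₀.1 (by
    intro i hi
    have : ((0 : Vec nx), z - y) = (x, z) - (x, y) := by simp
    rw [this, map_sub, h.2 i hi]
    exact sub_nonpos.2 (hz i))
  have h1 : (x₀, y₀) + ε • ((0 : Vec nx), z - y) = (x₀, y₀ + ε • (z - y)) := by simp
  rw [h1] at hmem
  have h2 := h₀.2 _ hmem
  rw [inner_add_right, inner_smul_right, inner_sub_right] at h2
  have h3 : 0 ≤ ε * (⟪c, z⟫ - ⟪c, y⟫) := by linarith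
  linarith [nonneg_of_mul_nonneg_right h3 hε]

/-- A face whose projection contains `x` is nonempty, hence one of the sets `tight g r I`. -/
lemma mem_chamber_iff [Finite ι] {x z : Vec nx} :
    z ∈ chamber (poly g r) x ↔
      ∀ I, x ∈ Prod.fst '' tight g r I → z ∈ Prod.fst '' tight g r I := by
  simp only [chamber, Set.mem_sInter, Set.mem_ofPred_eq]
  constructor
  · intro h I hx
    exact h _ ⟨hx, _, tight_mem_faces (Set.image_nonempty.1 ⟨x, hx⟩), rfl⟩
  · rintro h _ ⟨hx, F, hF, rfl⟩
    obtain ⟨I, rfl⟩ := exists_eq_tight_of_mem_faces hF (Set.image_nonempty.1 ⟨x, hx⟩)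
    exact h I hx

lemma self_mem_chamber (D : Set (Vec nx × Vec ny)) (x : Vec nx) : x ∈ chamber D x :=
  fun _ h => h.1

lemma chamber_eq_iInter [Finite ι] (x : Vec nx) :
    chamber (poly g r) x =
      ⋂ I ∈ {I | x ∈ Prod.fst '' tight g r I}, Prod.fst '' tight g r I := by
  ext z
  simp only [mem_chamber_iff, Set.mem_iInter, Set.mem_ofPred_eq]

lemma chamber_subset_domX [Finite ι] {x : Vec nx} (hx : x ∈ domX (poly g r)) :
    chamber (poly g r) x ⊆ domX (poly g r) := by
  intro z hz
  have := mem_chamber_iff.1 hz ∅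
  rw [tight_empty] at this
  exact this hx

lemma chamber_subset_chamber [Finite ι] {x z : Vec nx} (hz : z ∈ chamber (poly g r) x) :
    chamber (poly g r) z ⊆ chamber (poly g r) x := fun _ hw =>
  mem_chamber_iff.2 fun I hI => mem_chamber_iff.1 hw I (mem_chamber_iff.1 hz I hI)

lemma convex_chamber [Finite ι] (x : Vec nx) : Convex ℝ (chamber (poly g r) x) := by
  rw [chamber_eq_iInter]
  exact convex_iInter₂ fun I _ =>
    (convex_tight I).linear_image (LinearMap.fst ℝ (Vec nx) (Vec ny))

lemma isCompact_image_fst_tight (hD : IsCompact (poly g r)) (I : Set ι) :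
    IsCompact (Prod.fst '' tight g r I) :=
  (hD.of_isClosed_subset (isClosed_tight I) (tight_subset_poly I)).image continuous_fst

lemma isCompact_chamber [Finite ι] (hD : IsCompact (poly g r)) {x : Vec nx}
    (hx : x ∈ domX (poly g r)) : IsCompact (chamber (poly g r) x) := by
  refine (hD.image continuous_fst).of_isClosed_subset ?_ (chamber_subset_domX hx)
  rw [chamber_eq_iInter]
  exact isClosed_biInter fun I _ => (isCompact_image_fst_tight hD I).isClosed

lemma finite_chamberComplex [Finite ι] : (chamberComplex (poly g r)).Finite := by
  refine (Set.finite_range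
    fun A : Set (Set ι) => ⋂ I ∈ A, Prod.fst '' tight g r I).subset ?_
  rintro _ ⟨x, -, rfl⟩
  exact ⟨_, (chamber_eq_iInter x).symm⟩

/-- Every point is relatively interior to its chamber. -/
lemma mem_intrinsicInterior_chamber [Finite ι] (x : Vec nx) :
    x ∈ intrinsicInterior ℝ (chamber (poly g r) x) := by
  refine mem_intrinsicInterior_of_forall_extend (convex_chamber x) (self_mem_chamber _ x) ?_
  intro z hz
  have key : ∀ᶠ ε : ℝ in 𝓝[>] 0, ∀ I, x ∈ Prod.fst '' tight g r I →
      x + ε • (x - z) ∈ Prod.fst '' tight g r I := by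
    rw [eventually_all]
    intro I
    by_cases hI : x ∈ Prod.fst '' tight g r I
    swap
    · exact Eventually.of_forall fun _ h => absurd h hI
    obtain ⟨⟨_, y⟩, hxy, rfl⟩ := hI
    -- Lifting `z` to the smallest face through `(x, y)`, not just to `tight g r I`, keeps all
    -- constraints active at `(x, y)` constant along the line.
    obtain ⟨⟨_, w⟩, hzw, rfl⟩ := mem_chamber_iff.1 hz (act g r (_, y))
      ⟨_, mem_tight_act hxy.1, rfl⟩
    simp only at *
    rename_i x z
    have h0 : ∀ i ∈ act g r (x, y), g i ((x, y) - (z, w)) = 0 := fun i hi => by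
      rw [map_sub, hzw.2 i hi, hi, sub_self]
    filter_upwards [eventually_add_smul_mem_poly hxy.1 fun i hi => (h0 i hi).le] with ε hε _
    refine ⟨_, ⟨hε, fun i hi => ?_⟩, rfl⟩
    have hi' : i ∈ act g r (x, y) := hxy.2 i hi
    rw [map_add, map_smul, h0 i hi', smul_zero, add_zero, hi']
  obtain ⟨ε, h, hε⟩ := (key.and (self_mem_nhdsWithin : Set.Ioi (0 : ℝ) ∈ 𝓝[>] 0)).exists
  exact ⟨ε, hε, mem_chamber_iff.2 h⟩

/-- Over a chamber the fibers depend on the base point in a Minkowski-affine way. -/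
lemma exists_combination_of_mem_chamber [Finite ι] (hD : IsCompact (poly g r))
    {x₀ x₁ x₂ : Vec nx} (hx₀ : x₀ ∈ domX (poly g r)) (hx₁ : x₁ ∈ chamber (poly g r) x₀)
    (hx₂ : x₂ ∈ chamber (poly g r) x₀) {a b : ℝ} (ha : 0 ≤ a) (hb : 0 ≤ b) (hab : a + b = 1)
    {y : Vec ny} (hy : (a • x₁ + b • x₂, y) ∈ poly g r) :
    ∃ y₁ y₂, (x₁, y₁) ∈ poly g r ∧ (x₂, y₂) ∈ poly g r ∧ a • y₁ + b • y₂ = y := by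
  set K : Set (Vec ny) :=
    (fun p : Vec ny × Vec ny => a • p.1 + b • p.2) ''
      (fiber (poly g r) x₁ ×ˢ fiber (poly g r) x₂) with hK
  suffices h : y ∈ K by
    obtain ⟨⟨y₁, y₂⟩, ⟨h₁, h₂⟩, h⟩ := h
    exact ⟨y₁, y₂, h₁, h₂, h⟩
  have hconv : ∀ x, Convex ℝ (fiber (poly g r) x) := by
    intro x u hu v hv s t hs ht hst
    have := convex_poly hu hv hs ht hst
    have hx : s • (x, u) + t • (x, v) = (x, s • u + t • v) := by
      simp [← add_smul, hst]
    rwa [hx] at this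
  have hKconv : Convex ℝ K := by
    refine ((hconv x₁).prod (hconv x₂)).is_linear_image
      (f := fun p : Vec ny × Vec ny => a • p.1 + b • p.2) ⟨?_, ?_⟩
    · intro p q
      simp only [Prod.fst_add, Prod.snd_add]
      module
    · intro s p
      simp only [Prod.smul_fst, Prod.smul_snd]
      module
  have hKclosed : IsClosed K :=
    (((isCompact_fiber hD x₁).prod (isCompact_fiber hD x₂)).image (by fun_prop)).isClosed
  by_contra hyK
  -- With `c` representing the separating functional, the face through a minimizer over `x₀` also
  -- meets the fibers over `x₁` and `x₂`. The combination of these points minimizes `c` over its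
  -- fiber, yet `y` has a strictly smaller value.
  obtain ⟨f, u, hfy, hfK⟩ := geometric_hahn_banach_point_closed hKconv hKclosed hyK
  set c : Vec ny := (InnerProductSpace.toDual ℝ (Vec ny)).symm f with hc
  have hcf : ∀ z, ⟪c, z⟫ = f z := fun z => InnerProductSpace.toDual_symm_apply
  obtain ⟨y₀, h₀⟩ := exists_isMinimizer hD c hx₀
  have hmem : x₀ ∈ Prod.fst '' tight g r (act g r (x₀, y₀)) :=
    ⟨_, mem_tight_act h₀.1, rfl⟩
  obtain ⟨⟨x₁', y₁⟩, h₁, rfl⟩ := mem_chamber_iff.1 hx₁ _ hmem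
  obtain ⟨⟨x₂', y₂⟩, h₂, rfl⟩ := mem_chamber_iff.1 hx₂ _ hmem
  have h12 := (h₀.of_mem_tight (convex_tight _ h₁ h₂ ha hb hab)).2 y hy
  have := hfK (a • y₁ + b • y₂) ⟨(y₁, y₂), ⟨h₁.1, h₂.1⟩, rfl⟩
  rw [hcf, hcf] at h12
  simp only [Prod.smul_snd] at h12
  linarith

/-- The relative interiors of distinct chambers are disjoint. -/
lemma chamber_eq_of_mem_intrinsicInterior [Finite ι] (hD : IsCompact (poly g r))
    {x x₀ : Vec nx} (hx₀ : x₀ ∈ domX (poly g r))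
    (hx : x ∈ intrinsicInterior ℝ (chamber (poly g r) x₀)) :
    chamber (poly g r) x = chamber (poly g r) x₀ := by
  have hxC := intrinsicInterior_subset hx
  refine (chamber_subset_chamber hxC).antisymm (chamber_subset_chamber ?_)
  rw [mem_chamber_iff]
  rintro I ⟨⟨_, y⟩, hy, rfl⟩
  simp only at hxC hx
  rename_i x
  -- `x` lies strictly between `x₀` and a point of the chamber, so `(x, y)` splits accordingly;
  -- constraints tight at the average are tight at both ends, in particular over `x₀`.
  obtain ⟨ε, hε, hq⟩ := exists_pos_extend_of_mem_intrinsicInterior hx (self_mem_chamber _ x₀)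
  have ha : 0 < ε / (1 + ε) := by positivity
  have hb : 0 < 1 / (1 + ε) := by positivity
  have hab : ε / (1 + ε) + 1 / (1 + ε) = 1 := by field_simp; ring
  have he : (ε / (1 + ε)) • x₀ + (1 / (1 + ε)) • (x + ε • (x - x₀)) = x := by
    match_scalars <;> field_simp
    ring
  obtain ⟨y₁, y₂, h₁, h₂, h⟩ := exists_combination_of_mem_chamber hD hx₀
    (self_mem_chamber _ x₀) hq ha.le hb.le hab (y := y) (he.symm ▸ hy.1)
  refine ⟨(x₀, y₁), ⟨h₁, fun i hi => ?_⟩, rfl⟩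
  refine (act_midpoint_subset h₁ h₂ ha hb hab ?_).1
  have : (ε / (1 + ε)) • (x₀, y₁) + (1 / (1 + ε)) • (x + ε • (x - x₀), y₂) = (x, y) :=
    Prod.ext he h
  rw [this]
  exact hy.2 i hi

/-- `v` is relatively interior to its own chamber, a subset of the given one; a second point there
would put `v` strictly inside a segment. -/
lemma chamber_eq_singleton_of_mem_extremePoints [Finite ι] {v x₀ : Vec nx}
    (hv : v ∈ (chamber (poly g r) x₀).extremePoints ℝ) :
    chamber (poly g r) v = {v} := by
  refine Set.Subset.antisymm (fun z hz => ?_) (Set.singleton_subset_iff.2 (self_mem_chamber _ v))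
  by_contra hne
  obtain ⟨ε, hε, hq⟩ := exists_pos_extend_of_mem_intrinsicInterior
    (mem_intrinsicInterior_chamber v) hz
  have hsub := chamber_subset_chamber hv.1
  refine hne (hv.2 (hsub hz) (hsub hq) ⟨ε / (1 + ε), 1 / (1 + ε), by positivity, by positivity,
    by field_simp; ring, ?_⟩)
  match_scalars <;> field_simp
  ring

end Chambers

/-! ### Generic costs -/

/-- The set embeds isometrically in the unit sphere of the hyperplane orthogonal to `w`, where
Hausdorff measure of the full dimension is a Haar measure and spheres are null. -/
lemma hausdorffMeasure_sphere_orthogonal_eq_zero {n : ℕ} {w : Vec n} (hw : w ≠ 0) :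
    Measure.hausdorffMeasure ((n : ℝ) - 1) {c : Sphere n | ⟪(c : Vec n), w⟫ = 0} = 0 := by
  rcases n with _ | m
  · exact absurd (Subsingleton.elim w 0) hw
  have hm : ((m + 1 : ℕ) : ℝ) - 1 = m := by push_cast; ring
  rw [hm]
  set K : Submodule ℝ (Vec (m + 1)) := (ℝ ∙ w)ᗮ with hK
  have : Fact (Module.finrank ℝ (Vec (m + 1)) = m + 1) := ⟨by simp⟩
  have hfin : Module.finrank ℝ K = m := Submodule.finrank_orthogonal_span_singleton hw
  have hm0 : (0 : ℝ) ≤ m := Nat.cast_nonneg m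
  rw [← (isometry_subtype_coe (s := Metric.sphere (0 : Vec (m + 1)) 1)).hausdorffMeasure_image
    (Or.inl hm0)]
  refine measure_mono_null (t := K.subtypeₗᵢ '' Metric.sphere 0 1) ?_ ?_
  · rintro _ ⟨c, hc, rfl⟩
    have hcK : (c : Vec (m + 1)) ∈ K := by
      rw [hK, Submodule.mem_orthogonal_singleton_iff_inner_right, real_inner_comm]
      exact hc
    refine ⟨⟨c, hcK⟩, ?_, rfl⟩
    simp
  · rw [K.subtypeₗᵢ.isometry.hausdorffMeasure_image (Or.inl hm0)]
    have hnull : ∀ d : ℕ, Module.finrank ℝ K = d →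
        Measure.hausdorffMeasure (d : ℝ) (Metric.sphere (0 : K) 1) = 0 := by
      rintro _ rfl
      exact Measure.addHaar_sphere_of_ne_zero _ 0 one_ne_zero
    exact hnull m hfin

section Generic

variable {nx ny : ℕ} {ι : Type*} {g : ι → (Vec nx × Vec ny) →L[ℝ] ℝ} {r : ι → ℝ}

/-- The vertical directions along which the constraints of `I` are constant. -/
def flat (g : ι → (Vec nx × Vec ny) →L[ℝ] ℝ) (I : Set ι) : Set (Vec ny) :=
  {w | ∀ i ∈ I, g i (0, w) = 0}

/-- A cost is generic if it is orthogonal to no nontrivial space of directions `flat g I`. -/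
def IsGeneric (g : ι → (Vec nx × Vec ny) →L[ℝ] ℝ) (c : Vec ny) : Prop :=
  ∀ I, (∃ w ∈ flat g I, w ≠ 0) → ∃ w ∈ flat g I, ⟪c, w⟫ ≠ 0

lemma isClosed_setOf_orthogonal_flat (I : Set ι) :
    IsClosed {c : Sphere ny | ∀ w ∈ flat g I, ⟪(c : Vec ny), w⟫ = 0} := by
  simp only [Set.ofPred_forall]
  exact isClosed_biInter fun w _ => isClosed_eq (by fun_prop) continuous_const

lemma setOf_not_isGeneric :
    {c : Sphere ny | ¬ IsGeneric g c} =
      ⋃ I ∈ {I | ∃ w ∈ flat g I, w ≠ 0},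
        {c : Sphere ny | ∀ w ∈ flat g I, ⟪(c : Vec ny), w⟫ = 0} := by
  ext c
  simp only [IsGeneric, Set.mem_ofPred_eq, Set.mem_iUnion]
  push Not
  simp only [exists_prop]

lemma measurableSet_setOf_isGeneric [Finite ι] :
    MeasurableSet {c : Sphere ny | IsGeneric g c} := by
  rw [← MeasurableSet.compl_iff]
  change MeasurableSet {c : Sphere ny | ¬ IsGeneric g c}
  rw [setOf_not_isGeneric]
  exact MeasurableSet.biUnion (Set.to_countable _) fun I _ =>
    (isClosed_setOf_orthogonal_flat I).measurableSet

lemma ae_isGeneric [Finite ι] {Ω : Type*} [MeasurableSpace Ω] {P : Measure Ω}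
    {c : Ω → Sphere ny} (hna : HasNonatomicDistribution P c) :
    ∀ᵐ ω ∂P, IsGeneric g (c ω : Vec ny) := by
  refine hna {c | ¬ IsGeneric g c} measurableSet_setOf_isGeneric.compl ?_
  rw [setOf_not_isGeneric, measure_biUnion_null_iff (Set.to_countable _)]
  rintro I ⟨w, hw, hw0⟩
  exact measure_mono_null (fun c hc => hc w hw) (hausdorffMeasure_sphere_orthogonal_eq_zero hw0)

lemma neg_mem_flat {I : Set ι} {w : Vec ny} (hw : w ∈ flat g I) : -w ∈ flat g I := by
  intro i hi
  have : ((0 : Vec nx), -w) = -(0, w) := by simp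
  rw [this, map_neg, hw i hi, neg_zero]

lemma sub_mem_flat {I : Set ι} {x : Vec nx} {y z : Vec ny}
    (hy : ∀ i ∈ I, g i (x, y) = r i) (hz : ∀ i ∈ I, g i (x, z) = r i) : y - z ∈ flat g I := by
  intro i hi
  have : ((0 : Vec nx), y - z) = (x, y) - (x, z) := by simp
  rw [this, map_sub, hy i hi, hz i hi, sub_self]

lemma exists_pos_add_smul_flat [Finite ι] {x : Vec nx} {y w : Vec ny}
    (hxy : (x, y) ∈ poly g r) (hw : w ∈ flat g (act g r (x, y))) :
    ∃ ε > (0 : ℝ), (x, y + ε • w) ∈ poly g r := by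
  obtain ⟨ε, hε, h⟩ := exists_pos_add_smul_mem_poly (d := ((0 : Vec nx), w)) hxy
    fun i hi => (hw i hi).le
  refine ⟨ε, hε, ?_⟩
  convert h using 1
  simp

lemma IsMinimizer.inner_flat_eq_zero [Finite ι] {c : Vec ny} {x : Vec nx} {y w : Vec ny}
    (h : IsMinimizer (poly g r) c x y) (hw : w ∈ flat g (act g r (x, y))) : ⟪c, w⟫ = 0 := by
  have key : ∀ w ∈ flat g (act g r (x, y)), 0 ≤ ⟪c, w⟫ := by
    intro w hw
    obtain ⟨ε, hε, hmem⟩ := exists_pos_add_smul_flat h.1 hw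
    have := h.2 _ hmem
    rw [inner_add_right, inner_smul_right] at this
    exact nonneg_of_mul_nonneg_right (by linarith) hε
  have h1 := key _ (neg_mem_flat hw)
  rw [inner_neg_right] at h1
  linarith [key w hw]

lemma IsMinimizer.eq_zero_of_mem_flat [Finite ι] {c : Vec ny} {x : Vec nx} {y w : Vec ny}
    (hc : IsGeneric g c) (h : IsMinimizer (poly g r) c x y)
    (hw : w ∈ flat g (act g r (x, y))) : w = 0 := by
  by_contra hne
  obtain ⟨v, hv, hcv⟩ := hc _ ⟨w, hw, hne⟩
  exact hcv (h.inner_flat_eq_zero hv)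

/-- For a generic cost, the minimizer over each fiber is unique. -/
lemma IsMinimizer.unique [Finite ι] {c : Vec ny} {x : Vec nx} {y z : Vec ny}
    (hc : IsGeneric g c) (hy : IsMinimizer (poly g r) c x y)
    (hz : IsMinimizer (poly g r) c x z) : y = z := by
  have hmid : (1 / 2 : ℝ) • (x, y) + (1 / 2 : ℝ) • (x, z) =
      (x, (1 / 2 : ℝ) • y + (1 / 2 : ℝ) • z) := by
    refine Prod.ext ?_ rfl
    change (1 / 2 : ℝ) • x + (1 / 2 : ℝ) • x = x
    module
  have hmem := convex_poly hy.1 hz.1 (a := 1 / 2) (b := 1 / 2) (by norm_num) (by norm_num)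
    (by norm_num)
  have hact := act_midpoint_subset hy.1 hz.1 (a := 1 / 2) (b := 1 / 2) (by norm_num) (by norm_num)
    (by norm_num)
  rw [hmid] at hmem hact
  have hm : IsMinimizer (poly g r) c x ((1 / 2 : ℝ) • y + (1 / 2 : ℝ) • z) := by
    refine ⟨hmem, fun w hw => ?_⟩
    have h1 := hy.2 w hw
    have h2 := hz.2 w hw
    rw [inner_add_right, inner_smul_right, inner_smul_right]
    linarith
  -- Constraints active at the midpoint are active at `y` and `z`, so `y - z` is flat for a
  -- minimizer of a generic cost.
  exact sub_eq_zero.1 (hm.eq_zero_of_mem_flat hc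
    (sub_mem_flat (fun i hi => (hact hi).1) fun i hi => (hact hi).2))

/-- If the constraints of `I` determine `y`, they do so affinely in terms of `x`. -/
lemma exists_affine_of_flat_eq_zero {I : Set ι} (hI : ∀ w ∈ flat g I, w = 0) :
    ∃ (T : Vec nx →L[ℝ] Vec ny) (t : Vec ny), ∀ x y, (x, y) ∈ tight g r I → y = T x + t := by
  let B : Vec ny →ₗ[ℝ] (I → ℝ) :=
    LinearMap.pi fun i => (g i : (Vec nx × Vec ny) →ₗ[ℝ] ℝ) ∘ₗ LinearMap.inr ℝ _ _
  let A : Vec nx →ₗ[ℝ] (I → ℝ) :=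
    LinearMap.pi fun i => (g i : (Vec nx × Vec ny) →ₗ[ℝ] ℝ) ∘ₗ LinearMap.inl ℝ _ _
  have hB : LinearMap.ker B = ⊥ := by
    rw [LinearMap.ker_eq_bot']
    exact fun w hw => hI w fun i hi => congrFun hw ⟨i, hi⟩
  -- On the face `B y = r - A x`, and a left inverse of `B` solves this for `y`.
  obtain ⟨L, hL⟩ := B.exists_leftInverse_of_injective hB
  refine ⟨LinearMap.toContinuousLinearMap (-(L ∘ₗ A)), L fun i => r i, fun x y hxy => ?_⟩
  have h1 : B y = (fun i : I => r i) - A x := by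
    funext i
    have h2 : g i (x, y) = g i (x, 0) + g i (0, y) := by
      rw [← map_add]; simp
    have h3 := hxy.2 i i.2
    change g i (0, y) = r i - g i (x, 0)
    linarith
  have h4 : L (B y) = y := LinearMap.congr_fun hL y
  rw [← h4, h1, map_sub]
  simp [sub_eq_neg_add]

/-- Short moves along `w` and `-w` stay in the fiber, so the exposing functional vanishes on `w`; a
nonzero `w` would give a second maximizer. In particular a vertex is determined by its active set.
-/
lemma eq_zero_of_mem_flat_of_mem_vertices [Finite ι] {x : Vec nx} {v w : Vec ny}
    (hv : v ∈ vertices (fiber (poly g r) x)) (hw : w ∈ flat g (act g r (x, v))) : w = 0 := by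
  obtain ⟨l, hl⟩ := hv
  have hvl : v ∈ {z | z ∈ fiber (poly g r) x ∧ ∀ w ∈ fiber (poly g r) x, l w ≤ l z} :=
    hl ▸ Set.mem_singleton v
  have key : ∀ w ∈ flat g (act g r (x, v)), l w ≤ 0 := by
    intro w hw
    obtain ⟨ε, hε, hmem⟩ := exists_pos_add_smul_flat hvl.1 hw
    have := hvl.2 _ hmem
    rw [map_add, map_smul, smul_eq_mul] at this
    exact nonpos_of_mul_nonpos_right (by linarith) hε
  have h0 : l w = 0 := by
    have := key _ (neg_mem_flat hw)
    rw [map_neg] at this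
    linarith [key w hw]
  obtain ⟨ε, hε, hmem⟩ := exists_pos_add_smul_flat hvl.1 hw
  have : v + ε • w ∈ ({v} : Set (Vec ny)) := by
    rw [hl]
    refine ⟨hmem, fun z hz => ?_⟩
    rw [map_add, map_smul, h0, smul_zero, add_zero]
    exact hvl.2 z hz
  have h1 : ε • w = 0 := by simpa using this
  exact (smul_eq_zero.1 h1).resolve_left hε.ne'

lemma mem_of_mem_vertices {E : Type*} [NormedAddCommGroup E] [NormedSpace ℝ E] {A : Set E}
    {v : E} (hv : v ∈ vertices A) : v ∈ A := by
  obtain ⟨l, hl⟩ := hv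
  have h : v ∈ ({v} : Set E) := rfl
  rw [hl] at h
  exact h.1

lemma finite_vertices_fiber [Finite ι] (x : Vec nx) :
    (vertices (fiber (poly g r) x)).Finite := by
  refine Set.Finite.of_injOn (f := fun v => act g r (x, v)) (t := Set.univ)
    (fun _ _ => Set.mem_univ _) ?_ Set.finite_univ
  intro v hv w hw hvw
  have hvw' : act g r (x, v) = act g r (x, w) := hvw
  refine sub_eq_zero.1 (eq_zero_of_mem_flat_of_mem_vertices hv
    (sub_mem_flat (fun i hi => hi) fun i hi => ?_))
  rw [hvw'] at hi
  exact hi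

lemma IsMinimizer.mem_vertices [Finite ι] {c : Vec ny} {x : Vec nx} {y : Vec ny}
    (hc : IsGeneric g c) (hy : IsMinimizer (poly g r) c x y) :
    y ∈ vertices (fiber (poly g r) x) := by
  refine ⟨-(innerSL ℝ c), ?_⟩
  ext z
  simp only [Set.mem_singleton_iff, Set.mem_ofPred_eq, neg_apply,
    innerSL_apply_apply, neg_le_neg_iff]
  constructor
  · rintro rfl
    exact ⟨hy.1, fun w hw => hy.2 w hw⟩
  · rintro ⟨hz, h⟩
    exact IsMinimizer.unique hc ⟨hz, fun w hw => h w hw⟩ hy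

lemma neg_mem_normalCone_iff {D : Set (Vec nx × Vec ny)} {c : Vec ny} {x : Vec nx} {y : Vec ny}
    (hy : y ∈ fiber D x) : -c ∈ normalCone (fiber D x) y ↔ IsMinimizer D c x y := by
  simp only [normalCone, Set.mem_ofPred_eq, IsMinimizer, inner_neg_left, inner_sub_right]
  constructor
  · exact fun h => ⟨hy, fun z hz => by linarith [h z hz]⟩
  · exact fun h z hz => by linarith [h.2 z hz]

lemma measurableSet_setOf_isMinimizer (D : Set (Vec nx × Vec ny)) (x : Vec nx) (y : Vec ny) :
    MeasurableSet {c : Sphere ny | IsMinimizer D c x y} := by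
  by_cases h : (x, y) ∈ D
  · simp only [IsMinimizer, h, true_and, Set.ofPred_forall]
    refine IsClosed.measurableSet (isClosed_iInter fun z => isClosed_iInter fun _ => ?_)
    exact isClosed_le (by fun_prop) (by fun_prop)
  · simp [IsMinimizer, h]

/-- A measurable selection of minimizers, with finitely many values for each `x`. -/
lemma exists_simpleFunc_isMinimizer [Finite ι] (hD : IsCompact (poly g r)) :
    ∃ Φ : domX (poly g r) → SimpleFunc (Sphere ny) (domY (poly g r)),
      ∀ (x : domX (poly g r)) (c : Sphere ny), IsGeneric g (c : Vec ny) →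
        IsMinimizer (poly g r) c (x : Vec nx) (Φ x c : Vec ny) := by
  classical
  have hmin : ∀ (x : domX (poly g r)) (c : Sphere ny), ∃ y : domY (poly g r),
      IsMinimizer (poly g r) c (x : Vec nx) (y : Vec ny) := by
    intro x c
    obtain ⟨y, hy⟩ := exists_isMinimizer hD (c : Vec ny) x.2
    exact ⟨⟨y, _, hy.1, rfl⟩, hy⟩
  choose m hm using hmin
  have hne : ∀ x : domX (poly g r), Nonempty (domY (poly g r)) := by
    rintro ⟨_, ⟨p, hp, rfl⟩⟩
    exact ⟨⟨p.2, p, hp, rfl⟩⟩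
  let y₀ : domX (poly g r) → domY (poly g r) := fun x => (hne x).some
  -- The arbitrary choice `m` need not be measurable at nongeneric costs, so a constant replaces it
  -- there. At generic costs uniqueness identifies the level sets.
  let F : domX (poly g r) → Sphere ny → domY (poly g r) :=
    fun x c => if IsGeneric g (c : Vec ny) then m x c else y₀ x
  have hF : ∀ (x : domX (poly g r)) (c : Sphere ny), IsGeneric g (c : Vec ny) →
      IsMinimizer (poly g r) c (x : Vec nx) (F x c : Vec ny) := by
    intro x c hc
    simp only [F, hc, if_true]
    exact hm x c
  have hfib : ∀ x y, MeasurableSet (F x ⁻¹' {y}) := by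
    intro x y
    have : F x ⁻¹' {y} =
        ({c : Sphere ny | IsGeneric g (c : Vec ny)} ∩
          {c : Sphere ny | IsMinimizer (poly g r) c (x : Vec nx) (y : Vec ny)}) ∪
        ({c : Sphere ny | IsGeneric g (c : Vec ny)}ᶜ ∩ {_c | y₀ x = y}) := by
      ext c
      by_cases hc : IsGeneric g (c : Vec ny)
      · simp only [Set.mem_preimage, Set.mem_singleton_iff, Set.mem_union, Set.mem_inter_iff,
          Set.mem_ofPred_eq, hc, true_and, Set.mem_compl_iff, not_true_eq_false, false_and, or_false]
        constructor
        · rintro rfl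
          exact hF x c hc
        · exact fun h => Subtype.ext ((hF x c hc).unique hc h)
      · simp [F, hc]
    rw [this]
    exact (measurableSet_setOf_isGeneric.inter (measurableSet_setOf_isMinimizer _ _ _)).union
      (measurableSet_setOf_isGeneric.compl.inter (MeasurableSet.const _))
  have hrange : ∀ x, (Set.range (F x)).Finite := by
    intro x
    refine ((((finite_vertices_fiber (g := g) (r := r) (x : Vec nx)).preimage
      Subtype.val_injective.injOn)).insert (y₀ x)).subset ?_
    rintro _ ⟨c, rfl⟩
    by_cases hc : IsGeneric g (c : Vec ny)
    · exact Or.inr ((hF x c hc).mem_vertices hc)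
    · left
      simp [F, hc]
  exact ⟨fun x => ⟨F x, hfib x, hrange x⟩, hF⟩

end Generic

/-! ### The belief as the law of the follower's response -/

section Belief

variable {nx ny : ℕ} {ι : Type*} {g : ι → (Vec nx × Vec ny) →L[ℝ] ℝ} {r : ι → ℝ}
  {Ω : Type*} [MeasurableSpace Ω] {P : Measure Ω} {c : Ω → Sphere ny}

/-- Up to null sets, the event `-c ∈ N(v)` is `y = v`. These disjoint events exhaust `Ω`, because a
generic cost is minimized at a vertex. -/
lemma belief_eq_map [Finite ι] (hna : HasNonatomicDistribution P c) {x : domX (poly g r)}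
    {y : Ω → domY (poly g r)} (hy : Measurable y)
    (hmin : ∀ᵐ ω ∂P, IsMinimizer (poly g r) (c ω : Vec ny) (x : Vec nx) (y ω : Vec ny)) :
    belief (poly g r) P c x = P.map y := by
  have := (finite_vertices_fiber (g := g) (r := r) (x : Vec nx)).countable.to_subtype
  have hgen : ∀ᵐ ω ∂P, IsGeneric g (c ω : Vec ny) := ae_isGeneric hna
  have hdens : ∀ v : vertices (fiber (poly g r) (x : Vec nx)),
      vertexDensity (poly g r) P c (x : Vec nx) v =
        P {ω | y ω = ⟨v, mem_domY_of_mem_vertices _ _ v⟩} := by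
    intro v
    refine measure_congr ?_
    filter_upwards [hgen, hmin] with ω h1 h2
    refine propext ((neg_mem_normalCone_iff (mem_of_mem_vertices v.2)).trans ⟨fun h => ?_, ?_⟩)
    · exact Subtype.ext (h2.unique h1 h)
    · intro h
      have h' : y ω = ⟨v, mem_domY_of_mem_vertices _ _ v⟩ := h
      rw [h'] at h2
      exact h2
  ext s hs
  rw [Measure.map_apply hy hs, belief, Measure.sum_apply _ hs]
  have hsum : ∀ v : vertices (fiber (poly g r) (x : Vec nx)),
      (vertexDensity (poly g r) P c (x : Vec nx) v •
        Measure.dirac (⟨v, mem_domY_of_mem_vertices _ _ v⟩ : domY (poly g r))) s =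
      P {ω | y ω = ⟨v, mem_domY_of_mem_vertices _ _ v⟩ ∧ y ω ∈ s} := by
    intro v
    rw [Measure.smul_apply, Measure.dirac_apply' _ hs, hdens v, smul_eq_mul]
    by_cases hv : (⟨v, mem_domY_of_mem_vertices _ _ v⟩ : domY (poly g r)) ∈ s
    · rw [Set.indicator_of_mem hv, Pi.one_apply, mul_one]
      congr 1
      ext ω
      exact ⟨fun h => ⟨h, by rw [show y ω = _ from h]; exact hv⟩, fun h => h.1⟩
    · rw [Set.indicator_of_notMem hv, mul_zero]
      refine (measure_mono_null (t := ∅) ?_ measure_empty).symm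
      rintro ω ⟨h1, h2⟩
      exact hv (h1 ▸ h2)
  simp_rw [hsum]
  rw [← measure_iUnion]
  · refine measure_congr ?_
    filter_upwards [hgen, hmin] with ω h1 h2
    refine propext ⟨fun h => ?_, fun h => ?_⟩
    · obtain ⟨v, hv⟩ := Set.mem_iUnion.1 h
      exact hv.2
    · exact Set.mem_iUnion.2 ⟨⟨y ω, h2.mem_vertices h1⟩, rfl, h⟩
  · intro v w hvw
    refine Set.disjoint_left.2 fun ω h1 h2 => hvw (Subtype.ext ?_)
    exact congrArg (fun z : domY (poly g r) => (z : Vec ny)) (h1.1.symm.trans h2.1)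
  · intro v
    exact (hy (measurableSet_singleton _)).inter (hy hs)

/-- For a generic cost, the minimizer depends continuously on the leader's decision. -/
lemma continuous_of_isMinimizer [Finite ι] (hD : IsCompact (poly g r)) {c : Vec ny}
    (hc : IsGeneric g c) {y : domX (poly g r) → domY (poly g r)}
    (hy : ∀ x : domX (poly g r), IsMinimizer (poly g r) c (x : Vec nx) (y x : Vec ny)) : Continuous y := by
  have : CompactSpace (domY (poly g r)) :=
    isCompact_iff_compactSpace.1 (hD.image continuous_snd)
  set G : Set (domX (poly g r) × domY (poly g r)) := {p | p.2 = y p.1} with hG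
  -- A face through one point of the graph consists of minimizers, so by uniqueness it stays in the
  -- graph; only finitely many active sets occur.
  have hGeq : G = (fun p : domX (poly g r) × domY (poly g r) => ((p.1 : Vec nx), (p.2 : Vec ny))) ⁻¹'
      ⋃ x : domX (poly g r), tight g r (act g r ((x : Vec nx), (y x : Vec ny))) := by
    ext ⟨x, z⟩
    simp only [hG, Set.mem_ofPred_eq, Set.mem_preimage, Set.mem_iUnion]
    constructor
    · rintro rfl
      exact ⟨x, mem_tight_act (hy x).1⟩
    · rintro ⟨x', h⟩
      exact Subtype.ext (((hy x').of_mem_tight h).unique hc (hy x))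
  have hGclosed : IsClosed G := by
    rw [hGeq]
    refine IsClosed.preimage (by fun_prop) ?_
    have : (⋃ x : domX (poly g r), tight g r (act g r ((x : Vec nx), (y x : Vec ny)))) =
        ⋃ I ∈ Set.range fun x : domX (poly g r) => act g r ((x : Vec nx), (y x : Vec ny)),
          tight g r I := by
      rw [Set.biUnion_range]
    rw [this]
    exact (Set.toFinite _).isClosed_biUnion fun I _ => isClosed_tight I
  refine continuous_iff_isClosed.2 fun K hK => ?_
  have : y ⁻¹' K = Prod.fst '' (G ∩ Prod.snd ⁻¹' K) := by
    ext x
    constructor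
    · intro hx
      exact ⟨(x, y x), ⟨rfl, hx⟩, rfl⟩
    · rintro ⟨⟨x', z⟩, ⟨h1, h2⟩, rfl⟩
      have h1' : z = y x' := h1
      subst h1'
      exact h2
  rw [this]
  exact isClosedMap_fst_of_compactSpace _ (hGclosed.inter (hK.preimage continuous_snd))

end Belief

/-! ### Consequences for a selection of responses -/

section Selection

variable {X Y Ω : Type*} [TopologicalSpace X] [FirstCountableTopology X]
  [TopologicalSpace Y] [CompactSpace Y]
  [MeasurableSpace Ω] {P : Measure Ω} [IsProbabilityMeasure P] {y : X → Ω → Y}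

lemma continuous_integral_of_ae_continuous [MeasurableSpace Y] [BorelSpace Y]
    (hym : ∀ x, Measurable (y x))
    (hyc : ∀ᵐ ω ∂P, Continuous fun x => y x ω) {f : Y → ℝ} (hf : Continuous f) :
    Continuous fun x => ∫ ω, f (y x ω) ∂P := by
  obtain ⟨M, hM⟩ := isCompact_univ.exists_bound_of_continuousOn hf.continuousOn
  refine continuous_of_dominated (bound := fun _ => M) (fun x => ?_) (fun x => ?_)
    (integrable_const M) ?_
  · exact (hf.measurable.comp (hym x)).aestronglyMeasurable
  · exact Eventually.of_forall fun ω => hM _ (Set.mem_univ _)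
  · filter_upwards [hyc] with ω hω
    exact hf.comp hω

lemma exists_forall_integral_le_of_lowerSemicontinuous [Nonempty X] [CompactSpace X]
    (hyc : ∀ᵐ ω ∂P, Continuous fun x => y x ω) {f : X × Y → ℝ} (hf : LowerSemicontinuous f)
    (hint : ∀ x, Integrable (fun ω => f (x, y x ω)) P) :
    ∃ x₀, ∀ x, ∫ ω, f (x₀, y x₀ ω) ∂P ≤ ∫ ω, f (x, y x ω) ∂P := by
  obtain ⟨ω₀⟩ : Nonempty Ω := nonempty_of_isProbabilityMeasure P
  have : Nonempty (X × Y) := ⟨(Classical.arbitrary X, y (Classical.arbitrary X) ω₀)⟩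
  obtain ⟨p, -, hp⟩ := LowerSemicontinuousOn.exists_isMinOn Set.univ_nonempty
    isCompact_univ (lowerSemicontinuousOn_univ_iff.2 hf)
  set L := f p with hL
  have hLf : ∀ q, L ≤ f q := fun q => hp (Set.mem_univ q)
  -- Subtracting the minimum `L` makes the integrand nonnegative, as Fatou's lemma requires.
  set H : X → ENNReal := fun x => ∫⁻ ω, ENNReal.ofReal (f (x, y x ω) - L) ∂P with hH
  have hHlsc : LowerSemicontinuous H := by
    intro x
    refine lowerSemicontinuousAt_iff_le_liminf.2 ?_
    refine le_trans ?_ (lintegral_liminf_le' (μ := P) (u := 𝓝 x)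
      (f := fun x ω => ENNReal.ofReal (f (x, y x ω) - L))
      fun x => ((hint x).aemeasurable.sub_const L).ennreal_ofReal)
    refine lintegral_mono_ae ?_
    filter_upwards [hyc] with ω hω
    have h1 : LowerSemicontinuous fun x => f (x, y x ω) :=
      hf.comp (continuous_id.prodMk hω)
    have h2 : LowerSemicontinuous fun x => ENNReal.ofReal (f (x, y x ω) - L) :=
      (show Continuous fun t : ℝ => ENNReal.ofReal (t - L) from
        ENNReal.continuous_ofReal.comp (continuous_sub_right L)).comp_lowerSemicontinuous h1
        fun s t hst => ENNReal.ofReal_le_ofReal (by linarith)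
    exact lowerSemicontinuousAt_iff_le_liminf.1 (h2 x)
  obtain ⟨x₀, -, hx₀⟩ := LowerSemicontinuousOn.exists_isMinOn Set.univ_nonempty
    isCompact_univ (lowerSemicontinuousOn_univ_iff.2 hHlsc)
  have hHe : ∀ x, H x = ENNReal.ofReal (∫ ω, (f (x, y x ω) - L) ∂P) := fun x =>
    (ofReal_integral_eq_lintegral_ofReal ((hint x).sub (integrable_const L))
      (Eventually.of_forall fun ω => sub_nonneg.2 (hLf _))).symm
  refine ⟨x₀, fun x => ?_⟩
  have h := hx₀ (Set.mem_univ x)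
  simp only [Set.mem_ofPred_eq, hHe] at h
  rw [ENNReal.ofReal_le_ofReal_iff (integral_nonneg fun ω => sub_nonneg.2 (hLf _)),
    integral_sub (hint _) (integrable_const L), integral_sub (hint _) (integrable_const L)] at h
  linarith

end Selection

/-! ### The leader's objective -/

section Objective

variable {nx ny : ℕ} {ι : Type*} {g : ι → (Vec nx × Vec ny) →L[ℝ] ℝ} {r : ι → ℝ}
  {Ω : Type*} [MeasurableSpace Ω] {P : Measure Ω} {c : Ω → Sphere ny}
  {Φ : domX (poly g r) → SimpleFunc (Sphere ny) (domY (poly g r))}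

lemma ae_isMinimizer_selection [Finite ι]
    (hna : HasNonatomicDistribution P c)
    (hΦ : ∀ (x : domX (poly g r)) (c : Sphere ny), IsGeneric g (c : Vec ny) →
      IsMinimizer (poly g r) c (x : Vec nx) (Φ x c : Vec ny)) :
    ∀ᵐ ω ∂P, ∀ x : domX (poly g r),
      IsMinimizer (poly g r) (c ω : Vec ny) (x : Vec nx) (Φ x (c ω) : Vec ny) := by
  filter_upwards [ae_isGeneric (g := g) hna] with ω hω x using hΦ x (c ω) hω

lemma belief_eq_map_selection [Finite ι]
    (hc : Measurable c) (hna : HasNonatomicDistribution P c)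
    (hΦ : ∀ᵐ ω ∂P, ∀ x : domX (poly g r),
      IsMinimizer (poly g r) (c ω : Vec ny) (x : Vec nx) (Φ x (c ω) : Vec ny))
    (x : domX (poly g r)) :
    belief (poly g r) P c x = P.map fun ω => Φ x (c ω) :=
  belief_eq_map hna ((Φ x).measurable.comp hc) (hΦ.mono fun _ h => h x)

/-- The response to a fixed `x` takes finitely many values, so `u` may be arbitrary. -/
lemma integrable_comp_selection [IsProbabilityMeasure P] {E : Type*} [NormedAddCommGroup E]
    (hc : Measurable c) (x : domX (poly g r)) (u : domY (poly g r) → E) :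
    Integrable (fun ω => u (Φ x (c ω))) P :=
  SimpleFunc.integrable_of_isFiniteMeasure (((Φ x).comp c hc).map u)

lemma isBelief_of_eq_map [IsProbabilityMeasure P]
    (hc : Measurable c)
    (hΦ : ∀ᵐ ω ∂P, ∀ x : domX (poly g r),
      IsMinimizer (poly g r) (c ω : Vec ny) (x : Vec nx) (Φ x (c ω) : Vec ny))
    (hβ : ∀ x, belief (poly g r) P c x = P.map fun ω => Φ x (c ω))
    (hD : IsCompact (poly g r)) :
    IsBelief (poly g r) (belief (poly g r) P c) := by
  intro x
  have hm : Measurable fun ω => Φ x (c ω) := (Φ x).measurable.comp hc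
  rw [hβ x]
  refine ⟨Measure.isProbabilityMeasure_map hm.aemeasurable, ?_⟩
  have hs : MeasurableSet {y : domY (poly g r) | (y : Vec ny) ∈ fiber (poly g r) (x : Vec nx)} :=
    (isCompact_fiber hD (x : Vec nx)).isClosed.measurableSet.preimage measurable_subtype_coe
  rw [Measure.map_apply hm hs, ← measure_univ (μ := P)]
  refine measure_congr ?_
  filter_upwards [hΦ] with ω h
  exact propext ⟨fun _ => trivial, fun _ => (h x).1⟩

lemma theta_eq_integral_selection (hc : Measurable c)
    (hβ : ∀ x, belief (poly g r) P c x = P.map fun ω => Φ x (c ω))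
    (d₁ : Vec nx) (d₂ : Vec ny) (x : domX (poly g r)) :
    theta (poly g r) P c d₁ d₂ x =
      ⟪d₁, (x : Vec nx)⟫ + ∫ ω, ⟪d₂, (Φ x (c ω) : Vec ny)⟫ ∂P := by
  have hm : Measurable fun ω => Φ x (c ω) := (Φ x).measurable.comp hc
  have hcont : Continuous fun y : domY (poly g r) => ⟪d₂, (y : Vec ny)⟫ := by fun_prop
  rw [theta, hβ x, integral_map hm.aemeasurable hcont.aestronglyMeasurable]

lemma theta_affine_on_chamber [Finite ι] [IsProbabilityMeasure P]
    (hc : Measurable c) (hna : HasNonatomicDistribution P c)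
    (hΦ : ∀ᵐ ω ∂P, ∀ x : domX (poly g r),
      IsMinimizer (poly g r) (c ω : Vec ny) (x : Vec nx) (Φ x (c ω) : Vec ny))
    (hβ : ∀ x, belief (poly g r) P c x = P.map fun ω => Φ x (c ω))
    (d₁ : Vec nx) (d₂ : Vec ny) (x₀ : domX (poly g r)) :
    ∃ (d : Vec nx) (a : ℝ), ∀ x : domX (poly g r),
      (x : Vec nx) ∈ chamber (poly g r) (x₀ : Vec nx) →
        theta (poly g r) P c d₁ d₂ x = ⟪d, (x : Vec nx)⟫ + a := by
  -- Indexing the affine maps by the response `v` at `x₀` makes them simple functions of `ω`, hence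
  -- integrable. The zero default serves the `v` that are not determined by their active
  -- constraints.
  have hT : ∀ v : domY (poly g r), ∃ (T : Vec nx →L[ℝ] Vec ny) (t : Vec ny),
      (∀ w ∈ flat g (act g r ((x₀ : Vec nx), (v : Vec ny))), w = 0) →
        ∀ x y, (x, y) ∈ tight g r (act g r ((x₀ : Vec nx), (v : Vec ny))) → y = T x + t := by
    intro v
    by_cases h : ∀ w ∈ flat g (act g r ((x₀ : Vec nx), (v : Vec ny))), w = 0
    · obtain ⟨T, t, hTt⟩ := exists_affine_of_flat_eq_zero (r := r) h
      exact ⟨T, t, fun _ => hTt⟩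
    · exact ⟨0, 0, fun h' => absurd h' h⟩
  choose T t hTt using hT
  have hu : Integrable (fun ω => (T (Φ x₀ (c ω))).adjoint d₂) P :=
    integrable_comp_selection hc x₀ fun v => (T v).adjoint d₂
  have ht : Integrable (fun ω => ⟪d₂, t (Φ x₀ (c ω))⟫) P :=
    integrable_comp_selection hc x₀ fun v => ⟪d₂, t v⟫
  refine ⟨d₁ + ∫ ω, (T (Φ x₀ (c ω))).adjoint d₂ ∂P, ∫ ω, ⟪d₂, t (Φ x₀ (c ω))⟫ ∂P,
    fun x hx => ?_⟩
  have hae : (fun ω => ⟪d₂, (Φ x (c ω) : Vec ny)⟫) =ᵐ[P]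
      fun ω => ⟪(x : Vec nx), (T (Φ x₀ (c ω))).adjoint d₂⟫ + ⟪d₂, t (Φ x₀ (c ω))⟫ := by
    filter_upwards [ae_isGeneric (g := g) hna, hΦ] with ω hω hmin
    have h₀ := hmin x₀
    -- The lift of `x` to the face of the response at `x₀` is itself the response at `x`.
    obtain ⟨⟨x', y⟩, hy, hxy⟩ := mem_chamber_iff.1 hx _ ⟨_, mem_tight_act h₀.1, rfl⟩
    have hxy' : x' = x := hxy
    subst hxy'
    have hyΦ : y = (Φ x (c ω) : Vec ny) := (h₀.of_mem_tight hy).unique hω (hmin x)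
    have := hTt (Φ x₀ (c ω)) (fun w hw => h₀.eq_zero_of_mem_flat hω hw) _ _ hy
    rw [← hyΦ, this, inner_add_right, ContinuousLinearMap.adjoint_inner_right, real_inner_comm]
  rw [theta_eq_integral_selection hc hβ, integral_congr_ae hae,
    integral_add (hu.const_inner _) ht, integral_inner hu, inner_add_left,
    real_inner_comm (x : Vec nx) (∫ ω, (T (Φ x₀ (c ω))).adjoint d₂ ∂P)]
  ring

lemma isPiecewiseLinear_of_affine_on_chamber [Finite ι]
    (hD : IsCompact (poly g r))
    {f : domX (poly g r) → ℝ}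
    (hf : ∀ C ∈ chamberComplex (poly g r), ∃ (d : Vec nx) (a : ℝ), ∀ x : domX (poly g r),
      (x : Vec nx) ∈ C → f x = ⟪d, (x : Vec nx)⟫ + a) :
    IsPiecewiseLinear (poly g r) f := by
  classical
  refine ⟨finite_chamberComplex, ?_⟩
  have hf' : ∀ C, ∃ (d : Vec nx) (a : ℝ), C ∈ chamberComplex (poly g r) →
      ∀ x : domX (poly g r), (x : Vec nx) ∈ C → f x = ⟪d, (x : Vec nx)⟫ + a := by
    intro C
    by_cases hC : C ∈ chamberComplex (poly g r)
    · obtain ⟨d, a, h⟩ := hf C hC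
      exact ⟨d, a, fun _ => h⟩
    · exact ⟨0, 0, fun h => absurd h hC⟩
  choose d a hda using hf'
  refine ⟨d, a, fun x => ?_⟩
  have hCx : chamber (poly g r) (x : Vec nx) ∈ chamberComplex (poly g r) := ⟨x, x.2, rfl⟩
  -- Only the chamber of `x` contains `x` in its relative interior.
  rw [finsum_eq_single _ (chamber (poly g r) (x : Vec nx))]
  · rw [finsum_eq_if, if_pos hCx, Set.indicator_of_mem (mem_intrinsicInterior_chamber (x : Vec nx))]
    exact hda _ hCx x (self_mem_chamber _ _)
  · intro C hC
    rw [finsum_eq_if]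
    split_ifs with hCm
    · obtain ⟨x₀, hx₀, rfl⟩ := hCm
      exact Set.indicator_of_notMem
        (fun h => hC (chamber_eq_of_mem_intrinsicInterior hD hx₀ h).symm) _
    · rfl

/-- A continuous function on `X` that is affine on every chamber is minimized at a chamber
vertex. -/
lemma exists_chamberVertex_forall_le [Finite ι]
    (hD : IsCompact (poly g r)) (hne : (poly g r).Nonempty)
    {f : domX (poly g r) → ℝ} (hfc : Continuous f)
    (hf : ∀ C ∈ chamberComplex (poly g r), ∃ (d : Vec nx) (a : ℝ), ∀ x : domX (poly g r),
      (x : Vec nx) ∈ C → f x = ⟪d, (x : Vec nx)⟫ + a) :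
    ∃ v : domX (poly g r), (v : Vec nx) ∈ chamberVertices (poly g r) ∧ ∀ x, f v ≤ f x := by
  have : CompactSpace (domX (poly g r)) :=
    isCompact_iff_compactSpace.1 (hD.image continuous_fst)
  have : Nonempty (domX (poly g r)) := (hne.image Prod.fst).to_subtype
  obtain ⟨x₀, -, hx₀⟩ := isCompact_univ.exists_isMinOn Set.univ_nonempty hfc.continuousOn
  set C := chamber (poly g r) (x₀ : Vec nx) with hC
  obtain ⟨d, a, hda⟩ := hf C ⟨x₀, x₀.2, rfl⟩
  have hCX : C ⊆ domX (poly g r) := chamber_subset_domX x₀.2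
  have hx₀C : (x₀ : Vec nx) ∈ C := self_mem_chamber _ _
  -- The minimizers of `f` on `C` form a compact exposed face, whose extreme points are extreme in
  -- `C`.
  set M : Set (Vec nx) := {x ∈ C | ∀ z ∈ C, (-innerSL ℝ d) z ≤ (-innerSL ℝ d) x} with hM
  have hexp : IsExposed ℝ C M := fun _ => ⟨-innerSL ℝ d, rfl⟩
  have hx₀M : (x₀ : Vec nx) ∈ M := by
    refine ⟨hx₀C, fun z hz => ?_⟩
    have h1 : f x₀ ≤ f ⟨z, hCX hz⟩ := hx₀ (Set.mem_univ _)
    rw [hda x₀ hx₀C, hda ⟨z, hCX hz⟩ hz] at h1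
    simp only [neg_apply, innerSL_apply_apply]
    linarith
  obtain ⟨v, hv⟩ := (hexp.isCompact (isCompact_chamber hD x₀.2)).extremePoints_nonempty ⟨_, hx₀M⟩
  have hvM : v ∈ M := hv.1
  have hvX : v ∈ domX (poly g r) := hCX hvM.1
  have hsing := chamber_eq_singleton_of_mem_extremePoints
    (hexp.isExtreme.extremePoints_subset_extremePoints hv)
  refine ⟨⟨v, hvX⟩, ⟨hvX, v, hvX, hsing⟩, fun x => le_trans ?_ (hx₀ (Set.mem_univ x))⟩
  have h1 := hvM.2 _ hx₀C
  simp only [neg_apply, innerSL_apply_apply] at h1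
  rw [hda x₀ hx₀C, hda ⟨v, hvX⟩ hvM.1]
  linarith

end Objective

/-! ### The high-point relaxation -/

section HighPoint

variable {nx ny ml mf : ℕ} (Al : Matrix (Fin ml) (Fin nx) ℝ) (bl : Fin ml → ℝ)
  (Af : Matrix (Fin mf) (Fin nx) ℝ) (Bf : Matrix (Fin mf) (Fin ny) ℝ) (bf : Fin mf → ℝ)

/-- The left-hand sides of the constraints of the high-point relaxation. -/
noncomputable def highPointForm : Fin ml ⊕ Fin mf → (Vec nx × Vec ny) →L[ℝ] ℝ :=
  Sum.elim
    (fun i => (innerSL ℝ (WithLp.toLp 2 (Al i) : Vec nx)).comp (ContinuousLinearMap.fst ℝ _ _))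
    (fun i => (innerSL ℝ (WithLp.toLp 2 (Af i) : Vec nx)).comp (ContinuousLinearMap.fst ℝ _ _) +
      (innerSL ℝ (WithLp.toLp 2 (Bf i) : Vec ny)).comp (ContinuousLinearMap.snd ℝ _ _))

lemma inner_toLp_row {m n : ℕ} (A : Matrix (Fin m) (Fin n) ℝ) (i : Fin m) (x : Vec n) :
    ⟪(WithLp.toLp 2 (A i) : Vec n), x⟫ = (A *ᵥ x.ofLp) i := by
  simp [PiLp.inner_apply, Matrix.mulVec, dotProduct, mul_comm]

lemma highPoint_eq_poly :
    highPoint Al bl Af Bf bf = poly (highPointForm Al Af Bf) (Sum.elim bl bf) := by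
  ext p
  simp [highPoint, poly, highPointForm, followerFeasible, inner_toLp_row]

variable {Al bl Af Bf bf}

lemma fiber_highPoint {x : Vec nx} (hx : ∀ i, (Al *ᵥ x.ofLp) i ≤ bl i) (y : Vec ny) :
    (x, y) ∈ highPoint Al bl Af Bf bf ↔ y ∈ followerFeasible Af Bf bf x :=
  ⟨fun h => h.2, fun h => ⟨hx, h⟩⟩

lemma isFeasible_iff {Ω : Type*} [MeasurableSpace Ω] {P : Measure Ω} [IsProbabilityMeasure P]
    {c : Ω → Sphere ny} {x : Vec nx} {y : Ω → Vec ny} :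
    IsFeasible Al bl Af Bf bf P c x y ↔
      ∀ᵐ ω ∂P, IsMinimizer (highPoint Al bl Af Bf bf) (c ω : Vec ny) x (y ω) := by
  constructor
  · rintro ⟨hx, h⟩
    filter_upwards [h] with ω hω
    exact ⟨(fiber_highPoint hx _).2 hω.1, fun z hz => hω.2 z ((fiber_highPoint hx _).1 hz)⟩
  · intro h
    -- A single outcome already yields the leader's constraints, which do not involve `ω`.
    obtain ⟨ω, hω⟩ := h.exists
    have hx := hω.1.1
    refine ⟨hx, ?_⟩
    filter_upwards [h] with ω hω
    exact ⟨(fiber_highPoint hx _).1 hω.1, fun z hz => hω.2 z ((fiber_highPoint hx _).2 hz)⟩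

end HighPoint

end Bilevel

open Bilevel
theorem theorem1 {nx ny ml mf : ℕ}
    (Al : Matrix (Fin ml) (Fin nx) ℝ) (bl : Fin ml → ℝ)
    (Af : Matrix (Fin mf) (Fin nx) ℝ) (Bf : Matrix (Fin mf) (Fin ny) ℝ) (bf : Fin mf → ℝ)
    (d₁ : Vec nx) (d₂ : Vec ny)
    (D : Set (Vec nx × Vec ny)) (hD : D = highPoint Al bl Af Bf bf)
    (hDcompact : IsCompact D) (hDfull : (interior D).Nonempty)
    {Ω : Type*} [MeasurableSpace Ω] (P : Measure Ω) [IsProbabilityMeasure P]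
    (c : Ω → Sphere ny) (hc : Measurable c) (hna : HasNonatomicDistribution P c) :
    IsBelief D (belief D P c) ∧
    IsWeakContinuous D (belief D P c) ∧
    (∀ f : domX D × domY D → ℝ, LowerSemicontinuous f →
      (∀ x, Integrable (fun y => f (x, y)) (belief D P c x)) ∧
      ∃ x₀ : domX D, ∀ x : domX D,
        ∫ y, f (x₀, y) ∂(belief D P c x₀) ≤ ∫ y, f (x, y) ∂(belief D P c x)) ∧
    Continuous (theta D P c d₁ d₂) ∧
    IsPiecewiseLinear D (theta D P c d₁ d₂) ∧
    (∀ C ∈ chamberComplex D, ∃ (d : Vec nx) (a : ℝ), ∀ x : domX D, (x : Vec nx) ∈ C →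
      theta D P c d₁ d₂ x = ⟪d, (x : Vec nx)⟫ + a) ∧
    ∃ v : domX D, (v : Vec nx) ∈ chamberVertices D ∧
      (∀ x : domX D, theta D P c d₁ d₂ v ≤ theta D P c d₁ d₂ x) ∧
      IsSolution Al bl Af Bf bf P c d₁ d₂ v := by
  have hfeas : ∀ x y, IsFeasible Al bl Af Bf bf P c x y ↔
      ∀ᵐ ω ∂P, IsMinimizer D (c ω : Vec ny) x (y ω) := by
    subst hD
    exact fun x y => isFeasible_iff
  have hne : D.Nonempty := hDfull.mono interior_subset
  rw [highPoint_eq_poly] at hD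
  subst hD
  set g := highPointForm Al Af Bf with hg
  set r : Fin ml ⊕ Fin mf → ℝ := Sum.elim bl bf with hr
  obtain ⟨Φ, hΦgen⟩ := exists_simpleFunc_isMinimizer hDcompact
  have hΦ := ae_isMinimizer_selection hna hΦgen
  have hβ := belief_eq_map_selection hc hna hΦ
  have hΦm : ∀ x, Measurable fun ω => Φ x (c ω) := fun x => (Φ x).measurable.comp hc
  have : CompactSpace (domX (poly g r)) :=
    isCompact_iff_compactSpace.1 (hDcompact.image continuous_fst)
  have : CompactSpace (domY (poly g r)) :=
    isCompact_iff_compactSpace.1 (hDcompact.image continuous_snd)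
  have : Nonempty (domX (poly g r)) := (hne.image Prod.fst).to_subtype
  have hΦc : ∀ᵐ ω ∂P, Continuous fun x => Φ x (c ω) := by
    filter_upwards [ae_isGeneric (g := g) hna, hΦ] with ω h1 h2
    exact continuous_of_isMinimizer hDcompact h1 h2
  have hint : ∀ (f : domY (poly g r) → ℝ), Measurable f → ∀ x,
      ∫ y, f y ∂(belief (poly g r) P c x) = ∫ ω, f (Φ x (c ω)) ∂P := fun f hf x => by
    rw [hβ x, integral_map (hΦm x).aemeasurable hf.aestronglyMeasurable]
  have htheta := theta_eq_integral_selection hc hβ d₁ d₂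
  have hcont : Continuous (theta (poly g r) P c d₁ d₂) := by
    rw [funext htheta]
    refine Continuous.add (by fun_prop) ?_
    exact continuous_integral_of_ae_continuous hΦm hΦc
      (f := fun y : domY (poly g r) => ⟪d₂, (y : Vec ny)⟫) (by fun_prop)
  have haff : ∀ C ∈ chamberComplex (poly g r), ∃ (d : Vec nx) (a : ℝ),
      ∀ x : domX (poly g r), (x : Vec nx) ∈ C →
        theta (poly g r) P c d₁ d₂ x = ⟪d, (x : Vec nx)⟫ + a := by
    rintro _ ⟨x₀, hx₀, rfl⟩
    exact theta_affine_on_chamber hc hna hΦ hβ d₁ d₂ ⟨x₀, hx₀⟩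
  -- By uniqueness every feasible response agrees almost surely with `Φ`, so the choice among
  -- optimal responses does not affect the objective.
  have hobj : ∀ x y, IsFeasible Al bl Af Bf bf P c x y →
      Integrable (fun ω => ⟪d₂, y ω⟫) P ∧
        ∃ hx : x ∈ domX (poly g r),
          objective P d₁ d₂ x y = theta (poly g r) P c d₁ d₂ ⟨x, hx⟩ := by
    intro x y hxy
    have hmin := (hfeas x y).1 hxy
    obtain ⟨ω, hω⟩ := hmin.exists
    have hx : x ∈ domX (poly g r) := ⟨_, hω.1, rfl⟩
    have hae : (fun ω => ⟪d₂, (Φ ⟨x, hx⟩ (c ω) : Vec ny)⟫) =ᵐ[P] fun ω => ⟪d₂, y ω⟫ := by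
      filter_upwards [ae_isGeneric (g := g) hna, hΦ, hmin] with ω h1 h2 h3
      rw [(h2 ⟨x, hx⟩).unique h1 h3]
    refine ⟨(integrable_comp_selection hc ⟨x, hx⟩
      fun y : domY (poly g r) => ⟪d₂, (y : Vec ny)⟫).congr hae, hx, ?_⟩
    rw [htheta, objective, integral_congr_ae hae]
  refine ⟨isBelief_of_eq_map hc hΦ hβ hDcompact, ?_, ?_, hcont,
    isPiecewiseLinear_of_affine_on_chamber hDcompact haff, haff, ?_⟩
  · intro u x hu f hf
    simp only [hint f hf.measurable]
    exact ((continuous_integral_of_ae_continuous hΦm hΦc hf).tendsto x).comp hu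
  · intro f hf
    have hfm : ∀ x, Measurable fun y => f (x, y) := fun x =>
      (hf.comp (Continuous.prodMk_right x)).measurable
    refine ⟨fun x => ?_, ?_⟩
    · rw [hβ x, integrable_map_measure (hfm x).aestronglyMeasurable (hΦm x).aemeasurable]
      exact integrable_comp_selection hc x fun y => f (x, y)
    · simp only [fun x => hint _ (hfm x) x]
      exact exists_forall_integral_le_of_lowerSemicontinuous hΦc hf
        fun x => integrable_comp_selection hc x fun y => f (x, y)
  · obtain ⟨v, hv, hmin⟩ := exists_chamberVertex_forall_le hDcompact hne hcont haff
    refine ⟨v, hv, hmin, ⟨fun ω => Φ v (c ω), (hfeas _ _).2 (hΦ.mono fun _ h => h v)⟩,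
      fun x' y' h => (hobj x' y' h).1, fun y hy x' y' h => ?_⟩
    obtain ⟨-, hx, h1⟩ := hobj _ _ hy
    obtain ⟨-, hx', h2⟩ := hobj _ _ h
    rw [h1, h2]
    exact hmin _
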